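/- Let $n\ge 2$ and let $\mathbf p:[n]^2\to[0,1]$ be symmetric, $[n]=\{1,\dots,n\}$. Let $(I_{ij})_{1\le i\le j\le n}$ be independent $0/1$ random variables with $\Pr(I_{ij}=1)=\mathbf p(i,j)$, put $I_{ji}=I_{ij}$, and let $G_{\mathbf p}$ be the random graph on $[n]$ (loops allowed) whose edges are the pairs $ij$ with $I_{ij}=1$. Let $A_{\mathbf p}$ be its adjacency matrix, with entries $I_{ij}$, and let $L_{\mathbf p}=\mathrm{Id}-TA_{\mathbf p}T$ be its normalized Laplacian, where $T$ is the diagonal matrix with $i$-th diagonal entry $d_i^{-1/2}$ if $d_i\ne 0$ and $0$ if $d_i=0$, $d_i=\sum_{j}I_{ij}$ being the degree of $i$. Let $A_{\mathbf p}^{\rm typ}$ and $L_{\mathbf p}^{\rm typ}$ be the corresponding matrices of the weighted graph with weights $\mathbf p(i,j)$: that is, $A_{\mathbf p}^{\rm typ}=(\mathbf p(i,j))_{i,j}$, and $L_{\mathbf p}^{\rm typ}$ is defined by the same formula with weighted degrees $\sum_j\mathbf p(i,j)$. Let $\|\cdot\|$ be the operator norm induced by the Euclidean norm, and put $$d=\min_{i}\sum_{j=1}^n\mathbf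 p(i,j),\qquad \Delta=\max_{i}\sum_{j=1}^n\mathbf p(i,j).$$ Theorem. For every constant $c>0$ there is a constant $C=C(c)>0$, independent of $n$ and $\mathbf p$, such that the following holds for all $n$ and $\mathbf p$ as above. If $\Delta>C\ln n$, then for all $n^{-c}\le\delta\le 1/2$, $$\Pr\left(\|A_{\mathbf p}-A_{\mathbf p}^{\rm typ}\|\le 4\sqrt{\Delta\ln(n/\delta)}\right)\ge 1-\delta.$$ Moreover, if $d\ge C\ln n$, then for all $n^{-c}\le\delta\le 1/2$, $$\Pr\left(\|L_{\mathbf p}-L_{\mathbf p}^{\rm typ}\|\le 14\sqrt{\frac{\ln(4n/\delta)}{d}}\right)\ge 1-\delta.$$ -/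

import Mathlib

open MeasureTheory ProbabilityTheory

noncomputable section

/-- Finite graphs in which loops are allowed and parallel edges are not: the edge set is given by a
symmetric relation, `Adj i i` meaning that there is a loop at `i`. -/
structure LoopGraph (V : Type*) where
  Adj : V → V → Prop
  symm : ∀ i j, Adj i j → Adj j i

/-- Weighted graphs: a symmetric non-negative weight function (weight `0` means no edge). -/
structure WeightedGraph (V : Type*) where
  w : V → V → ℝ
  symm : ∀ i j, w i j = w j i
  nonneg : ∀ i j, 0 ≤ w i j

/-- The matrix `I - T A T`, where `T` is diagonal with entries `deg i ^ (-1/2)`,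
or `0` when `deg i = 0`. -/
def laplacianOf {V : Type*} [Fintype V] [DecidableEq V] (A : Matrix V V ℝ) (deg : V → ℝ) :
    Matrix V V ℝ :=
  let T : Matrix V V ℝ :=
    Matrix.diagonal fun i => if deg i = 0 then 0 else deg i ^ (-(1 / 2) : ℝ)
  1 - T * A * T

namespace LoopGraph

variable {V : Type*} (G : LoopGraph V)

/-- The number of `j` such that `ij` is an edge (a loop counts once). -/
def degree (i : V) : ℕ := {j | G.Adj i j}.ncard

open Classical in
def adjMatrix : Matrix V V ℝ := Matrix.of fun i j => if G.Adj i j then 1 else 0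

def laplacian [Fintype V] [DecidableEq V] : Matrix V V ℝ :=
  laplacianOf G.adjMatrix fun i => (G.degree i : ℝ)

end LoopGraph

namespace WeightedGraph

variable {V : Type*} (H : WeightedGraph V)

def degree [Fintype V] (i : V) : ℝ := ∑ j, H.w i j

def adjMatrix : Matrix V V ℝ := Matrix.of H.w

def laplacian [Fintype V] [DecidableEq V] : Matrix V V ℝ :=
  laplacianOf H.adjMatrix H.degree

def minDegree [Fintype V] : ℝ := ⨅ i, H.degree i

def maxDegree [Fintype V] : ℝ := ⨆ i, H.degree i

end WeightedGraph

/-- The norm of a real square matrix as an operator on Euclidean space. -/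
def opNormL2 {V : Type*} [Fintype V] [DecidableEq V] (M : Matrix V V ℝ) : ℝ :=
  ‖Matrix.toEuclideanCLM (n := V) (𝕜 := ℝ) M‖

/-- Symmetric functions `[n]² → [0,1]`. -/
structure EdgeProb (n : ℕ) where
  p : Fin n → Fin n → ℝ
  symm : ∀ i j, p i j = p j i
  nonneg : ∀ i j, 0 ≤ p i j
  le_one : ∀ i j, p i j ≤ 1

/-- The weighted graph whose weights are the edge probabilities. -/
def EdgeProb.typ {n : ℕ} (p : EdgeProb n) : WeightedGraph (Fin n) where
  w := p.p
  symm := p.symm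
  nonneg := p.nonneg

/-- A family `I i j = I j i` of `0/1` random variables, independent for `i ≤ j`, such that
`I i j = 1` has probability `p i j`. -/
structure EdgeIndicators {n : ℕ} (p : EdgeProb n) {Ω : Type*} [MeasurableSpace Ω]
    (P : Measure Ω) where
  I : Fin n → Fin n → Ω → ℝ
  measurable : ∀ i j, Measurable (I i j)
  zero_or_one : ∀ i j ω, I i j ω = 0 ∨ I i j ω = 1
  symm : ∀ i j, I i j = I j i
  indep : iIndepFun (fun q : {q : Fin n × Fin n // q.1 ≤ q.2} => I q.1.1 q.1.2) P
  prob_one : ∀ i j, P.real {ω | I i j ω = 1} = p.p i j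

/-- The random graph with independent edges: `ij` is an edge exactly when `I i j = 1`. -/
def EdgeIndicators.graph {n : ℕ} {p : EdgeProb n} {Ω : Type*} [MeasurableSpace Ω]
    {P : Measure Ω} (X : EdgeIndicators p P) (ω : Ω) : LoopGraph (Fin n) where
  Adj i j := X.I i j ω = 1
  symm i j h := by rw [X.symm j i]; exact h

end

/-! Both deviations are controlled by sums of independent centred Bernoulli variables times fixed
symmetric matrices, one per unordered pair. Such a sum `S` obeys a Bernstein bound `2n·exp(-θt +
θ²σ)`, where `σ` bounds the total variance `∑ p M²`, not the sum of the norms of its terms. To get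
this, `tr exp(θS)` is written as `tr exp(H + ∑ Y)`, where each increment `Y` carries its own
compensator `-θ²pM²` and `H = θ² ∑ p M²` restores the balance. Golden–Thompson peels off one
increment at a time (`integral_trace_exp_add_sum_le`); each costs nothing because `E exp Y ≤ 1` as
matrices, so only `tr exp H` remains.

For the adjacency matrix this applies directly with `σ = Δ`. For the Laplacian it applies to the
adjacency deviation conjugated by the typical degrees to the power `-1/2`, and to the diagonal
matrix of relative degree errors, both with `σ = 1/d`. The rest is deterministic
(`norm_laplacian_sub_le`): replacing the random normalization by the typical one perturbs a
contraction by conjugation with a diagonal matrix close to the identity. -/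

open Filter Topology NormedSpace
open scoped Matrix Matrix.Norms.L2Operator

/-! ### The Lie–Trotter formula. -/

section LieTrotter

theorem norm_pow_sub_pow_le_of_norm_le {R : Type*} [NormedRing R] [NormOneClass R] {x y : R}
    {K : ℝ} (hx : ‖x‖ ≤ K) (hy : ‖y‖ ≤ K) (hK : 1 ≤ K) (m : ℕ) :
    ‖x ^ m - y ^ m‖ ≤ m * ‖x - y‖ * K ^ m := by
  induction m with
  | zero => simp
  | succ j ih =>
    have h : x ^ (j + 1) - y ^ (j + 1) = x * (x ^ j - y ^ j) + (x - y) * y ^ j := by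
      rw [pow_succ', pow_succ']; noncomm_ring
    have hyj : ‖y ^ j‖ ≤ K ^ j := (norm_pow_le y j).trans (by gcongr)
    have hKj : K ^ j ≤ K ^ (j + 1) := pow_le_pow_right₀ hK (Nat.le_succ j)
    calc ‖x ^ (j + 1) - y ^ (j + 1)‖
        ≤ ‖x‖ * ‖x ^ j - y ^ j‖ + ‖x - y‖ * ‖y ^ j‖ := by
          rw [h]
          exact (norm_add_le _ _).trans (add_le_add (norm_mul_le _ _) (norm_mul_le _ _))
      _ ≤ K * (j * ‖x - y‖ * K ^ j) + ‖x - y‖ * K ^ (j + 1) := by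
          gcongr
          exact hyj.trans hKj
      _ = ((j + 1 : ℕ) : ℝ) * ‖x - y‖ * K ^ (j + 1) := by push_cast; ring

theorem norm_exp_le_exp_norm {R : Type*} [NormedRing R] [NormedAlgebra ℝ R] [NormOneClass R]
    [CompleteSpace R] (x : R) : ‖exp x‖ ≤ Real.exp ‖x‖ := by
  let : NormedAlgebra ℚ R := NormedAlgebra.restrictScalars ℚ ℝ R
  rw [Real.exp_eq_exp_ℝ, exp_eq_tsum ℝ, exp_eq_tsum ℝ]
  have hs : Summable fun k : ℕ => ((k.factorial : ℝ)⁻¹) • ‖x‖ ^ k :=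
    expSeries_summable' (𝕂 := ℝ) (𝔸 := ℝ) ‖x‖
  refine tsum_of_norm_bounded hs.hasSum fun k => ?_
  rw [norm_smul, Real.norm_of_nonneg (by positivity), smul_eq_mul]
  gcongr
  exact norm_pow_le x k

/-- The Lie–Trotter product formula along the powers of two. -/
theorem tendsto_exp_mul_exp_pow_two_pow {R : Type*} [NormedRing R] [NormedAlgebra ℝ R]
    [NormOneClass R] [CompleteSpace R] (a b : R) :
    Tendsto (fun k : ℕ => (exp (((2 : ℝ) ^ k)⁻¹ • a) * exp (((2 : ℝ) ^ k)⁻¹ • b)) ^ 2 ^ k)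
      atTop (𝓝 (exp (a + b))) := by
  let : NormedAlgebra ℚ R := NormedAlgebra.restrictScalars ℚ ℝ R
  set f : ℝ → R := fun t => exp (t • a) * exp (t • b) - exp (t • (a + b)) with hf
  -- The two curves agree to first order at `0`, so their gap at `1/m` is `o(1/m)`; telescoping the
  -- `m`-th powers costs only a factor `m`.
  have hder : HasDerivAt f 0 0 := by
    have h := ((hasDerivAt_exp_smul_const a (0 : ℝ)).mul
      (hasDerivAt_exp_smul_const b (0 : ℝ))).sub (hasDerivAt_exp_smul_const (a + b) (0 : ℝ))
    exact h.congr_deriv (by simp)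
  have hf0 : f 0 = 0 := by simp [hf]
  have hlim : Tendsto (fun k : ℕ => (2 : ℝ) ^ k * ‖f ((2 ^ k)⁻¹)‖) atTop (𝓝 0) := by
    have h1 : Tendsto (fun k : ℕ => ((2 : ℝ) ^ k)⁻¹) atTop (𝓝[≠] 0) := by
      refine tendsto_nhdsWithin_iff.2 ⟨?_, Eventually.of_forall fun k => by simp⟩
      exact (tendsto_pow_atTop_atTop_of_one_lt (by norm_num : (1 : ℝ) < 2)).inv_tendsto_atTop
    have h2 := (hder.tendsto_slope_zero.comp h1).norm
    refine (by simpa using h2 : Tendsto _ _ (𝓝 (0 : ℝ))).congr fun k => ?_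
    simp [hf0, norm_smul]
  rw [tendsto_iff_norm_sub_tendsto_zero]
  refine squeeze_zero (fun _ => norm_nonneg _) (fun k => ?_)
    (by simpa using hlim.mul_const (Real.exp (‖a‖ + ‖b‖)))
  set m : ℕ := 2 ^ k with hm
  have hm0 : (m : ℝ) ≠ 0 := by simp [hm]
  have hmc : (2 : ℝ) ^ k = m := by simp [hm]
  have hy : exp (a + b) = exp ((m : ℝ)⁻¹ • (a + b)) ^ m := by
    rw [← exp_nsmul, ← Nat.cast_smul_eq_nsmul ℝ, smul_smul, mul_inv_cancel₀ hm0, one_smul]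
  have hb : ∀ c : R, ‖(m : ℝ)⁻¹ • c‖ = (m : ℝ)⁻¹ * ‖c‖ := fun c => by
    rw [norm_smul, Real.norm_of_nonneg (by positivity)]
  -- This common bound is chosen so that `K ^ m` does not depend on `m`.
  set K := Real.exp ((m : ℝ)⁻¹ * (‖a‖ + ‖b‖)) with hK
  have hK1 : 1 ≤ K := Real.one_le_exp (by positivity)
  have hKm : K ^ m = Real.exp (‖a‖ + ‖b‖) := by
    rw [hK, ← Real.exp_nat_mul, ← mul_assoc, mul_inv_cancel₀ hm0, one_mul]
  rw [hmc, hy]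
  refine (norm_pow_sub_pow_le_of_norm_le (K := K) ?_ ?_ hK1 m).trans_eq (by rw [hKm])
  · refine (norm_mul_le _ _).trans ?_
    rw [hK, mul_add, Real.exp_add]
    gcongr
    · exact (norm_exp_le_exp_norm _).trans_eq (by rw [hb])
    · exact (norm_exp_le_exp_norm _).trans_eq (by rw [hb])
  · refine (norm_exp_le_exp_norm _).trans ?_
    rw [hb, hK]
    gcongr
    exact norm_add_le a b

end LieTrotter

/-! ### Trace inequalities and Golden–Thompson. -/

namespace Matrix

theorem trace_mul_transpose_self_nonneg {V : Type*} [Fintype V] (A : Matrix V V ℝ) : 0 ≤ trace (A * Aᵀ) := by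
  simp only [trace, diag, mul_apply, transpose_apply]
  exact Finset.sum_nonneg fun i _ => Finset.sum_nonneg fun j _ => mul_self_nonneg _

theorem abs_trace_mul_le {V : Type*} [Fintype V] (A B : Matrix V V ℝ) :
    |trace (A * B)| ≤ √(trace (A * Aᵀ)) * √(trace (B * Bᵀ)) := by
  rw [← Real.sqrt_mul (trace_mul_transpose_self_nonneg A)]
  refine Real.abs_le_sqrt ?_
  rw [trace_mul_comm B Bᵀ]
  simp only [trace, diag, mul_apply, transpose_apply, ← Finset.sum_product', ← sq]
  exact Finset.sum_mul_sq_le_sq_mul_sq _ _ _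

variable {V : Type*} [Fintype V] [DecidableEq V]

theorem trace_mul_pow_comm (A B : Matrix V V ℝ) (m : ℕ) :
    trace ((A * B) ^ m) = trace ((B * A) ^ m) := by
  cases m with
  | zero => simp
  | succ m =>
    have h : (A * B) ^ m * A = A * (B * A) ^ m := by
      induction m with
      | zero => simp
      | succ m ih => rw [pow_succ', mul_assoc, ih, pow_succ']; simp only [mul_assoc]
    rw [pow_succ, ← mul_assoc, h, mul_assoc, trace_mul_comm, mul_assoc, ← pow_succ]

/-- The two claims feed each other. The first, applied to `Z ^ 2`, reduces by cyclicity to the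
product of `Zᵀ * Z` and `Z * Zᵀ`, whose powers have equal traces, so the second finishes it. The
second follows from the first for `P * Q`, since `P Q² P` and `P² Q²` have powers of equal trace.
Cauchy–Schwarz is the base case. -/
theorem abs_trace_pow_two_pow_le_and (k : ℕ) :
    (∀ Z : Matrix V V ℝ, |trace (Z ^ 2 ^ (k + 1))| ≤ trace ((Z * Zᵀ) ^ 2 ^ k)) ∧
    (∀ P Q : Matrix V V ℝ, P.IsSymm → Q.IsSymm →
      |trace ((P * Q) ^ 2 ^ k)| ≤ √(trace (P ^ 2 ^ (k + 1))) * √(trace (Q ^ 2 ^ (k + 1)))) := by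
  induction k with
  | zero =>
    refine ⟨fun Z => ?_, fun P Q hP hQ => ?_⟩
    · have h := abs_trace_mul_le Z Z
      rw [Real.mul_self_sqrt (trace_mul_transpose_self_nonneg Z)] at h
      simpa [sq] using h
    · simpa [sq, hP.eq, hQ.eq] using abs_trace_mul_le P Q
  | succ k ih =>
    obtain ⟨ihZ, ihPQ⟩ := ih
    refine ⟨fun Z => ?_, fun P Q hP hQ => ?_⟩
    · have h1 := ihZ (Z ^ 2)
      have h2 := ihPQ (Zᵀ * Z) (Z * Zᵀ) (by simp [IsSymm]) (by simp [IsSymm])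
      have h3 : trace ((Z ^ 2 * (Z ^ 2)ᵀ) ^ 2 ^ k) = trace ((Zᵀ * Z * (Z * Zᵀ)) ^ 2 ^ k) := by
        rw [show Z ^ 2 * (Z ^ 2)ᵀ = (Z * (Z * Zᵀ)) * Zᵀ by
          simp [sq, mul_assoc], trace_mul_pow_comm]
        simp only [mul_assoc]
      rw [trace_mul_pow_comm Zᵀ Z, Real.mul_self_sqrt] at h2
      · rw [← pow_mul, ← pow_succ', h3] at h1
        exact h1.trans ((le_abs_self _).trans h2)
      · rw [pow_succ, pow_mul, sq]
        have hs : ((Z * Zᵀ) ^ 2 ^ k)ᵀ = (Z * Zᵀ) ^ 2 ^ k := by simp [transpose_pow]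
        nth_rewrite 2 [← hs]
        exact trace_mul_transpose_self_nonneg _
    · have h1 := ihZ (P * Q)
      have h2 := ihPQ (P ^ 2) (Q ^ 2) (by simp [IsSymm, transpose_pow, hP.eq])
        (by simp [IsSymm, transpose_pow, hQ.eq])
      have h3 : trace ((P * Q * (P * Q)ᵀ) ^ 2 ^ k) = trace ((P ^ 2 * Q ^ 2) ^ 2 ^ k) := by
        rw [show P * Q * (P * Q)ᵀ = (P * Q ^ 2) * P by
          simp [sq, mul_assoc, hP.eq, hQ.eq], trace_mul_pow_comm]
        simp only [sq, mul_assoc]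
      rw [h3] at h1
      simp only [← pow_mul, ← pow_succ'] at h2
      exact h1.trans ((le_abs_self _).trans h2)

theorem trace_mul_pow_two_pow_le {P Q : Matrix V V ℝ} (hP : P.IsSymm) (hQ : Q.IsSymm) (k : ℕ) :
    trace ((P * Q) ^ 2 ^ k) ≤ trace (P ^ 2 ^ k * Q ^ 2 ^ k) := by
  induction k generalizing P Q with
  | zero => simp
  | succ k ih =>
    have h1 := (abs_trace_pow_two_pow_le_and k).1 (P * Q)
    have h3 : trace ((P * Q * (P * Q)ᵀ) ^ 2 ^ k) = trace ((P ^ 2 * Q ^ 2) ^ 2 ^ k) := by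
      rw [show P * Q * (P * Q)ᵀ = (P * Q ^ 2) * P by
        simp [sq, mul_assoc, hP.eq, hQ.eq], trace_mul_pow_comm]
      simp only [sq, mul_assoc]
    have h2 := ih (P := P ^ 2) (Q := Q ^ 2) (by simp [IsSymm, transpose_pow, hP.eq])
        (by simp [IsSymm, transpose_pow, hQ.eq])
    rw [h3] at h1
    simp only [← pow_mul, ← pow_succ'] at h2
    exact (le_abs_self _).trans (h1.trans h2)

/-- The Golden–Thompson inequality for real symmetric matrices. -/
theorem trace_exp_add_le {A B : Matrix V V ℝ} (hA : A.IsSymm) (hB : B.IsSymm) :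
    trace (exp (A + B)) ≤ trace (exp A * exp B) := by
  cases isEmpty_or_nonempty V
  · simp [trace]
  let : NormedAlgebra ℚ (Matrix V V ℝ) := NormedAlgebra.restrictScalars ℚ ℝ _
  have h1 : Continuous (trace : Matrix V V ℝ → ℝ) := Continuous.matrix_trace continuous_id
  refine le_of_tendsto ((h1.tendsto _).comp (tendsto_exp_mul_exp_pow_two_pow A B))
    (Eventually.of_forall fun k => ?_)
  refine (trace_mul_pow_two_pow_le ?_ ?_ k).trans_eq ?_
  · exact IsSymm.exp (hA.smul _)
  · exact IsSymm.exp (hB.smul _)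
  -- Raising to the power `2 ^ k` undoes the scaling, so the bound is the same for every `k` and
  -- survives the limit.
  · have h2 : ∀ C : Matrix V V ℝ, exp (((2 : ℝ) ^ k)⁻¹ • C) ^ 2 ^ k = exp C := fun C => by
      rw [← NormedSpace.exp_nsmul, ← Nat.cast_smul_eq_nsmul ℝ, smul_smul]
      simp
    rw [h2, h2]

end Matrix

/-! ### Diagonalization and traces of exponentials. -/

namespace Matrix

variable {V : Type*} [Fintype V] [DecidableEq V]

theorem IsSymm.exists_eq_mul_diagonal_mul {M : Matrix V V ℝ} (hM : M.IsSymm) :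
    ∃ (U : Matrix V V ℝ) (m : V → ℝ), Uᵀ * U = 1 ∧ M = U * diagonal m * Uᵀ ∧ ‖m‖ = ‖M‖ := by
  have hH : M.IsHermitian := by
    rw [IsHermitian, conjTranspose_eq_transpose_of_trivial]; exact hM
  have hs := hH.spectral_theorem
  rw [Unitary.conjStarAlgAut_apply] at hs
  have hst : ((star hH.eigenvectorUnitary : unitaryGroup V ℝ) : Matrix V V ℝ) =
      (hH.eigenvectorUnitary : Matrix V V ℝ)ᵀ := by
    rw [Unitary.coe_star, star_eq_conjTranspose, conjTranspose_eq_transpose_of_trivial]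
  refine ⟨hH.eigenvectorUnitary, hH.eigenvalues, ?_, ?_, ?_⟩
  · rw [← hst, Unitary.coe_star]
    exact Unitary.coe_star_mul_self _
  · rw [← hst]; exact hs
  · conv_rhs => rw [hs]
    rw [← Unitary.coe_star, CStarRing.norm_mul_coe_unitary, CStarRing.norm_coe_unitary_mul,
      l2_opNorm_diagonal]
    rfl

theorem exp_mul_diagonal_mul {U : Matrix V V ℝ} (hU : Uᵀ * U = 1) (m : V → ℝ) :
    exp (U * diagonal m * Uᵀ) = U * diagonal (fun i => Real.exp (m i)) * Uᵀ := by
  have hi : U⁻¹ = Uᵀ := inv_eq_left_inv hU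
  have hu : IsUnit U := IsUnit.of_mul_eq_one_right Uᵀ hU
  rw [← hi, exp_conj _ _ hu, exp_diagonal]
  congr 3
  ext i
  rw [Pi.coe_exp, Real.exp_eq_exp_ℝ]

theorem smul_add_smul_mul_diagonal_mul (U : Matrix V V ℝ) (a b : ℝ) (f g : V → ℝ) :
    a • (U * diagonal f * Uᵀ) + b • (U * diagonal g * Uᵀ) =
      U * diagonal (fun i => a * f i + b * g i) * Uᵀ := by
  have h : diagonal (fun i => a * f i + b * g i) = a • diagonal f + b • diagonal g := by
    rw [← diagonal_smul, ← diagonal_smul, diagonal_add]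
    rfl
  rw [h, mul_add, add_mul]
  simp

theorem trace_mul_diagonal_mul {U : Matrix V V ℝ} (hU : Uᵀ * U = 1) (m : V → ℝ) :
    trace (U * diagonal m * Uᵀ) = ∑ i, m i := by
  rw [trace_mul_comm, ← mul_assoc, hU, one_mul, trace_diagonal]

theorem exp_eq_mul_transpose {H : Matrix V V ℝ} (hH : H.IsSymm) :
    ∃ F : Matrix V V ℝ, exp H = F * Fᵀ := by
  refine ⟨exp ((2 : ℝ)⁻¹ • H), ?_⟩
  have hs : (exp ((2 : ℝ)⁻¹ • H)).IsSymm := IsSymm.exp (hH.smul _)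
  rw [hs.eq, ← sq, ← exp_nsmul, ← Nat.cast_smul_eq_nsmul ℝ, smul_smul]
  simp

theorem trace_exp_nonneg {H : Matrix V V ℝ} (hH : H.IsSymm) : 0 ≤ trace (exp H) := by
  obtain ⟨F, hF⟩ := exp_eq_mul_transpose hH
  rw [hF]
  exact trace_mul_transpose_self_nonneg F

/-- Pairing with the positive semidefinite `exp H` is monotone, and `U * diagonal q * Uᵀ` lies below
the identity. In the eigenbasis the weights of `exp H` are the nonnegative diagonal entries of `G *
Gᵀ`. -/
theorem trace_exp_mul_le {H : Matrix V V ℝ} (hH : H.IsSymm) {U : Matrix V V ℝ}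
    (hU : Uᵀ * U = 1) {q : V → ℝ} (hq : ∀ i, q i ≤ 1) :
    trace (exp H * (U * diagonal q * Uᵀ)) ≤ trace (exp H) := by
  obtain ⟨F, hF⟩ := exp_eq_mul_transpose hH
  have hU' : U * Uᵀ = 1 := mul_eq_one_comm.1 hU
  set G := Uᵀ * F
  have key : ∀ r : V → ℝ, trace (exp H * (U * diagonal r * Uᵀ)) = ∑ i, (G * Gᵀ) i i * r i := by
    intro r
    rw [hF, ← mul_assoc, trace_mul_comm]
    rw [show Uᵀ * (F * Fᵀ * (U * diagonal r)) = (G * Gᵀ) * diagonal r by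
      simp [G, mul_assoc]]
    simp [trace]
  have h1 : trace (exp H) = ∑ i, (G * Gᵀ) i i * (fun _ : V => (1 : ℝ)) i := by
    rw [← key]; simp [hU']
  rw [h1, key]
  refine Finset.sum_le_sum fun i _ => mul_le_mul_of_nonneg_left (hq i) ?_
  simp only [mul_apply, transpose_apply]
  exact Finset.sum_nonneg fun j _ => mul_self_nonneg _

/-- The norm is the largest `|m i|` over the eigenvalues. Depending on the sign of that eigenvalue,
one of the two traces contains a term at least `exp (θ t)`, and all other terms are positive. -/
theorem exp_lt_trace_exp_add_trace_exp_neg {S : Matrix V V ℝ} (hS : S.IsSymm) {θ t : ℝ}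
    (hθ : 0 ≤ θ) (ht : 0 ≤ t) (h : t < ‖S‖) :
    Real.exp (θ * t) ≤ trace (exp (θ • S)) + trace (exp (-θ • S)) := by
  obtain ⟨U, m, hU, hm, hn⟩ := hS.exists_eq_mul_diagonal_mul
  have key : ∀ s : ℝ, trace (exp (s • S)) = ∑ i, Real.exp (s * m i) := by
    intro s
    rw [hm, show s • (U * diagonal m * Uᵀ) = U * diagonal (s • m) * Uᵀ by
      rw [diagonal_smul]; simp, exp_mul_diagonal_mul hU, trace_mul_diagonal_mul hU]
    simp
  obtain ⟨i, hi⟩ : ∃ i, t < |m i| := by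
    by_contra! hc
    rw [← hn] at h
    exact absurd ((pi_norm_le_iff_of_nonneg ht).2 hc) (not_le.2 h)
  have hle : ∀ s : ℝ, Real.exp (s * m i) ≤ trace (exp (s • S)) := fun s => by
    rw [key]
    exact Finset.single_le_sum (f := fun i => Real.exp (s * m i))
      (fun _ _ => (Real.exp_pos _).le) (Finset.mem_univ i)
  have hpos := fun s : ℝ => (Real.exp_pos (s * m i)).le.trans (hle s)
  rcases lt_abs.1 hi with h1 | h1
  · refine le_add_of_le_of_nonneg ((Real.exp_le_exp.2 ?_).trans (hle θ)) (hpos _)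
    exact mul_le_mul_of_nonneg_left h1.le hθ
  · refine le_add_of_nonneg_of_le (hpos _) ((Real.exp_le_exp.2 ?_).trans (hle (-θ)))
    rw [neg_mul, ← mul_neg]
    exact mul_le_mul_of_nonneg_left h1.le hθ

end Matrix

/-! ### Matrix Bernstein inequality. -/

theorem bernoulli_mgf_le {p x : ℝ} (hp : 0 ≤ p) (hx : |x| ≤ 1) :
    (1 - p) * Real.exp (-p * x - p * x ^ 2) + p * Real.exp ((1 - p) * x - p * x ^ 2) ≤ 1 := by
  have h1 : Real.exp x ≤ 1 + x + x ^ 2 := by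
    have := (abs_le.1 (Real.abs_exp_sub_one_sub_id_le hx)).2
    linarith
  have h2 : (1 - p) * Real.exp (-p * x - p * x ^ 2) + p * Real.exp ((1 - p) * x - p * x ^ 2) =
      Real.exp (-(p * x + p * x ^ 2)) * ((1 - p) + p * Real.exp x) := by
    rw [show (1 - p) * x - p * x ^ 2 = -(p * x + p * x ^ 2) + x by ring, Real.exp_add]
    rw [show -p * x - p * x ^ 2 = -(p * x + p * x ^ 2) by ring]
    ring
  have h3 : (1 - p) + p * Real.exp x ≤ Real.exp (p * x + p * x ^ 2) := by
    have := Real.add_one_le_exp (p * x + p * x ^ 2)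
    nlinarith [mul_le_mul_of_nonneg_left h1 hp]
  rw [h2]
  calc _ ≤ Real.exp (-(p * x + p * x ^ 2)) * Real.exp (p * x + p * x ^ 2) := by gcongr
    _ = 1 := by rw [← Real.exp_add]; simp

section MatrixBernstein

open Matrix

variable {V : Type*} [Fintype V] [DecidableEq V]

/-- The exponent `θ (x - p) M - θ² p M²` of a compensated Bernoulli matrix increment. -/
noncomputable def bernoulliExponent (θ p : ℝ) (M : Matrix V V ℝ) (x : ℝ) : Matrix V V ℝ :=
  (θ * (x - p)) • M - (θ ^ 2 * p) • M ^ 2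

theorem isSymm_bernoulliExponent (θ p : ℝ) {M : Matrix V V ℝ} (hM : M.IsSymm) (x : ℝ) :
    (bernoulliExponent θ p M x).IsSymm := by
  unfold bernoulliExponent
  simp [IsSymm, transpose_pow, hM.eq]

theorem continuous_bernoulliExponent (θ p : ℝ) (M : Matrix V V ℝ) :
    Continuous (bernoulliExponent θ p M) := by
  unfold bernoulliExponent
  fun_prop

/-- Both exponents are functions of the single matrix `M`, so they are diagonal in one basis and the
scalar bound `bernoulli_mgf_le` applies to each eigenvalue of `θ M`. -/
theorem trace_exp_mul_bernoulli_le {θ p : ℝ} {M H : Matrix V V ℝ} (hp : 0 ≤ p) (hM : M.IsSymm)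
    (hH : H.IsSymm) (hθ : |θ| * ‖M‖ ≤ 1) :
    (1 - p) * trace (exp H * exp (bernoulliExponent θ p M 0)) +
      p * trace (exp H * exp (bernoulliExponent θ p M 1)) ≤ trace (exp H) := by
  obtain ⟨U, m, hU, hm, hn⟩ := hM.exists_eq_mul_diagonal_mul
  have key : ∀ x, exp (bernoulliExponent θ p M x) = U * diagonal (fun i =>
      Real.exp ((x - p) * (θ * m i) - p * (θ * m i) ^ 2)) * Uᵀ := by
    intro x
    rw [← exp_mul_diagonal_mul hU]
    have h2 : M ^ 2 = U * diagonal (fun i => m i * m i) * Uᵀ := by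
      rw [← diagonal_mul_diagonal, sq, hm]
      calc U * diagonal m * Uᵀ * (U * diagonal m * Uᵀ)
          = U * diagonal m * (Uᵀ * U) * diagonal m * Uᵀ := by simp only [mul_assoc]
        _ = _ := by rw [hU, mul_one]; simp only [mul_assoc]
    rw [bernoulliExponent, h2]
    conv_lhs => rw [hm]
    rw [sub_eq_add_neg, ← neg_smul, smul_add_smul_mul_diagonal_mul]
    congr 4
    ext i
    ring
  have h4 := trace_exp_mul_le hH hU (q := fun i =>
    (1 - p) * Real.exp ((0 - p) * (θ * m i) - p * (θ * m i) ^ 2) +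
      p * Real.exp ((1 - p) * (θ * m i) - p * (θ * m i) ^ 2)) (fun i => by
        rw [zero_sub]
        refine bernoulli_mgf_le hp ?_
        rw [abs_mul]
        refine le_trans ?_ hθ
        rw [← hn]
        gcongr
        exact norm_le_pi_norm m i)
  refine le_of_eq_of_le ?_ h4
  rw [key, key, ← smul_add_smul_mul_diagonal_mul, mul_add, trace_add, mul_smul_comm,
    mul_smul_comm, trace_smul, trace_smul, smul_eq_mul, smul_eq_mul]

theorem integrable_comp_zero_one {ι Ω : Type*} [Fintype ι] [MeasurableSpace Ω] {P : Measure Ω}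
    [IsFiniteMeasure P] {J : ι → Ω → ℝ} (hJ : ∀ k, Measurable (J k))
    (h01 : ∀ k ω, J k ω = 0 ∨ J k ω = 1) {g : (ι → ℝ) → ℝ} (hg : Continuous g) :
    Integrable (fun ω => g fun k => J k ω) P := by
  obtain ⟨C, hC⟩ := (isCompact_Icc (a := (0 : ι → ℝ)) (b := 1)).exists_bound_of_continuousOn
    hg.continuousOn
  refine Integrable.of_bound (C := C) ?_ (Eventually.of_forall fun ω => hC _ ?_)
  · exact (hg.measurable.comp (measurable_pi_lambda _ hJ)).aestronglyMeasurable
  · constructor <;> intro k <;> rcases h01 k ω with h | h <;> simp [h]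

/-- The compensated exponential behaves as a supermartingale: averaging out any one increment does
not raise the trace. A general `H` is allowed so that the total compensator can be put back. -/
theorem integral_trace_exp_add_sum_le {κ Ω : Type*} [DecidableEq κ] [MeasurableSpace Ω]
    {P : Measure Ω} [IsProbabilityMeasure P] {J : κ → Ω → ℝ} (hJ : ∀ k, Measurable (J k))
    (h01 : ∀ k ω, J k ω = 0 ∨ J k ω = 1) (hind : iIndepFun J P) {θ : ℝ}
    {M : κ → Matrix V V ℝ} (hM : ∀ k, (M k).IsSymm) (hθ : ∀ k, |θ| * ‖M k‖ ≤ 1)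
    {H : Matrix V V ℝ} (hH : H.IsSymm) (s : Finset κ) :
    ∫ ω, trace (exp (H + ∑ k ∈ s, bernoulliExponent θ (∫ ω, J k ω ∂P) (M k) (J k ω))) ∂P
      ≤ trace (exp H) := by
  let : NormedAlgebra ℚ (Matrix V V ℝ) := NormedAlgebra.restrictScalars ℚ ℝ _
  set Y : κ → ℝ → Matrix V V ℝ := fun k => bernoulliExponent θ (∫ ω, J k ω ∂P) (M k) with hY
  have hYs : ∀ k x, (Y k x).IsSymm := fun k x => isSymm_bernoulliExponent _ _ (hM k) x
  have hYc : ∀ k, Continuous (Y k) := fun k => continuous_bernoulliExponent _ _ _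
  have hZs : ∀ (s : Finset κ) ω, (H + ∑ k ∈ s, Y k (J k ω)).IsSymm := fun s ω =>
    hH.add (by simp [IsSymm, transpose_sum, (hYs _ _).eq])
  have hcont : ∀ (s : Finset κ) (B : Matrix V V ℝ), Continuous fun x : s → ℝ =>
      trace (exp (H + ∑ k : s, Y k (x k)) * B) := by
    intro s B
    refine Continuous.matrix_trace (Continuous.mul (exp_continuous.comp ?_) continuous_const)
    refine continuous_const.add (continuous_finsetSum _ fun k _ => ?_)
    exact (hYc k).comp (continuous_apply k)
  have hint : ∀ (s : Finset κ) (B : Matrix V V ℝ),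
      Integrable (fun ω => trace (exp (H + ∑ k ∈ s, Y k (J k ω)) * B)) P := by
    intro s B
    refine (integrable_comp_zero_one (fun k : s => hJ k) (fun k ω => h01 k ω)
      (hcont s B)).congr (Eventually.of_forall fun ω => ?_)
    simp only [Finset.sum_coe_sort s fun k => Y k (J k ω)]
  have hJint : ∀ k, Integrable (J k) P := fun k =>
    Integrable.of_bound (C := 1) (hJ k).aestronglyMeasurable
      (Eventually.of_forall fun ω => by rcases h01 k ω with h | h <;> simp [h])
  induction s using Finset.induction_on with
  | empty => simp
  | insert a s ha ih =>
    set Z : Ω → Matrix V V ℝ := fun ω => H + ∑ k ∈ s, Y k (J k ω) with hZ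
    set p := ∫ ω, J a ω ∂P with hp
    have hp0 : 0 ≤ p := integral_nonneg fun ω => by rcases h01 a ω with h | h <;> simp [h]
    -- As `J a` is `0` or `1`, `exp (Y a (J a ω))` interpolates its two values linearly.
    -- Independence is then needed only between scalar variables.
    have hpt : ∀ ω, trace (exp (H + ∑ k ∈ insert a s, Y k (J k ω))) ≤
        (1 - J a ω) * trace (exp (Z ω) * exp (Y a 0)) +
          J a ω * trace (exp (Z ω) * exp (Y a 1)) := by
      intro ω
      have hgt := trace_exp_add_le (hZs s ω) (hYs a (J a ω))
      rw [Finset.sum_insert ha, add_comm (Y a (J a ω)), ← add_assoc]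
      refine hgt.trans_eq ?_
      rcases h01 a ω with h | h <;> simp [h, hZ]
    have hindep : ∀ B : Matrix V V ℝ, IndepFun (J a) (fun ω => trace (exp (Z ω) * B)) P := by
      intro B
      have h1 := hind.indepFun_finset {a} s (by simpa using ha) hJ
      have hev : Measurable fun x : ({a} : Finset κ) → ℝ => x ⟨a, by simp⟩ :=
        measurable_pi_apply _
      have h2 := h1.comp hev (hcont s B).measurable
      have heq : (fun ω => trace (exp (Z ω) * B)) =
          (fun x : s → ℝ => trace (exp (H + ∑ k : s, Y k (x k)) * B)) ∘ fun ω k => J k ω := by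
        ext ω
        simp only [hZ, Function.comp, Finset.sum_coe_sort s fun k => Y k (J k ω)]
      rw [heq]
      exact h2
    have hprod : ∀ B : Matrix V V ℝ, Integrable (fun ω => J a ω * trace (exp (Z ω) * B)) P :=
      fun B => (hindep B).integrable_mul (hJint a) (hint s B)
    have hmul : ∀ B : Matrix V V ℝ, ∫ ω, J a ω * trace (exp (Z ω) * B) ∂P =
        p * ∫ ω, trace (exp (Z ω) * B) ∂P := fun B =>
      (hindep B).integral_fun_mul_eq_mul_integral (hJ a).aestronglyMeasurable
        (hint s B).aestronglyMeasurable
    have hsub : ∀ B : Matrix V V ℝ, Integrable (fun ω => (1 - J a ω) * trace (exp (Z ω) * B)) P :=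
      fun B => ((hint s B).sub (hprod B)).congr (Eventually.of_forall fun ω => by
        simp only [Pi.sub_apply, hZ]; ring)
    calc ∫ ω, trace (exp (H + ∑ k ∈ insert a s, Y k (J k ω))) ∂P
        ≤ ∫ ω, ((1 - J a ω) * trace (exp (Z ω) * exp (Y a 0)) +
          J a ω * trace (exp (Z ω) * exp (Y a 1))) ∂P :=
          integral_mono (by simpa using hint (insert a s) 1) ((hsub _).add (hprod _)) hpt
      _ = ∫ ω, ((1 - p) * trace (exp (Z ω) * exp (Y a 0)) +
          p * trace (exp (Z ω) * exp (Y a 1))) ∂P := by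
          rw [integral_add (hsub _) (hprod _), integral_add ((hint s _).const_mul _)
            ((hint s _).const_mul _), hmul, integral_const_mul, integral_const_mul]
          congr 1
          simp only [sub_mul, one_mul]
          rw [integral_sub (hint s _) (hprod _), hmul]
      _ ≤ ∫ ω, trace (exp (Z ω)) ∂P :=
          integral_mono (((hint s _).const_mul _).add ((hint s _).const_mul _))
            (by simpa using hint s 1)
            fun ω => trace_exp_mul_bernoulli_le hp0 (hM a) (hZs s ω) (hθ a)
      _ ≤ trace (exp H) := ih

/-- A matrix Bernstein inequality for sums of fixed symmetric matrices with independent centred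
Bernoulli coefficients, whose total variance is dominated by a diagonal matrix. -/
theorem measureReal_lt_norm_sum_bernoulli_le {κ Ω : Type*} [Fintype κ] [DecidableEq κ]
    [MeasurableSpace Ω] {P : Measure Ω} [IsProbabilityMeasure P] {J : κ → Ω → ℝ}
    (hJ : ∀ k, Measurable (J k)) (h01 : ∀ k ω, J k ω = 0 ∨ J k ω = 1) (hind : iIndepFun J P)
    {M : κ → Matrix V V ℝ} (hM : ∀ k, (M k).IsSymm) {v : V → ℝ} {σ θ t : ℝ}
    (hv : ∑ k, (∫ ω, J k ω ∂P) • M k ^ 2 = diagonal v) (hσ : ∀ i, v i ≤ σ) (hθ0 : 0 ≤ θ)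
    (hθ : ∀ k, θ * ‖M k‖ ≤ 1) (ht : 0 ≤ t) :
    P.real {ω | t < ‖∑ k, (J k ω - ∫ ω, J k ω ∂P) • M k‖} ≤
      2 * Fintype.card V * Real.exp (-θ * t + θ ^ 2 * σ) := by
  let : NormedAlgebra ℚ (Matrix V V ℝ) := NormedAlgebra.restrictScalars ℚ ℝ _
  set S : Ω → Matrix V V ℝ := fun ω => ∑ k, (J k ω - ∫ ω, J k ω ∂P) • M k with hS
  have hSs : ∀ ω, (S ω).IsSymm := fun ω => by simp [hS, IsSymm, transpose_sum, (hM _).eq]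
  have hmgf : ∀ η : ℝ, |η| = θ → ∫ ω, trace (exp (η • S ω)) ∂P ≤
      Fintype.card V * Real.exp (θ ^ 2 * σ) := by
    intro η hη
    have hη2 : η ^ 2 = θ ^ 2 := by rw [← hη, sq_abs]
    have h1 := integral_trace_exp_add_sum_le hJ h01 hind (θ := η) hM (fun k => by
      rw [hη]; exact hθ k) (H := diagonal (η ^ 2 • v)) (by simp [IsSymm]) Finset.univ
    -- The starting matrix cancels the sum of the compensators.
    have h2 : ∀ ω, diagonal (η ^ 2 • v) +
        ∑ k, bernoulliExponent η (∫ ω, J k ω ∂P) (M k) (J k ω) = η • S ω := by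
      intro ω
      rw [diagonal_smul, ← hv, hS]
      simp only [bernoulliExponent, Finset.sum_sub_distrib, Finset.smul_sum, smul_smul]
      abel
    simp only [h2] at h1
    refine h1.trans ?_
    rw [exp_diagonal, trace_diagonal]
    calc ∑ i, (exp (η ^ 2 • v)) i ≤ ∑ i : V, Real.exp (θ ^ 2 * σ) := by
          refine Finset.sum_le_sum fun i _ => ?_
          rw [Pi.coe_exp, ← Real.exp_eq_exp_ℝ, hη2]
          refine Real.exp_le_exp.2 ?_
          exact mul_le_mul_of_nonneg_left (hσ i) (sq_nonneg _)
      _ = _ := by simp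
  have hint : ∀ η : ℝ, Integrable (fun ω => trace (exp (η • S ω))) P := by
    intro η
    refine integrable_comp_zero_one hJ h01
      (g := fun x => trace (exp (η • ∑ k, (x k - ∫ ω, J k ω ∂P) • M k))) ?_
    refine Continuous.matrix_trace (exp_continuous.comp ?_)
    fun_prop
  have hsum : ∫ ω, (trace (exp (θ • S ω)) + trace (exp (-θ • S ω))) ∂P ≤
      2 * Fintype.card V * Real.exp (θ ^ 2 * σ) := by
    rw [integral_add (hint _) (hint _)]
    linarith [hmgf θ (abs_of_nonneg hθ0), hmgf (-θ) (by rw [abs_neg, abs_of_nonneg hθ0])]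
  have hmk := mul_meas_ge_le_integral_of_nonneg
    (Eventually.of_forall fun ω => add_nonneg (trace_exp_nonneg ((hSs ω).smul θ))
      (trace_exp_nonneg ((hSs ω).smul (-θ)))) ((hint θ).add (hint (-θ))) (Real.exp (θ * t))
  have hsubset : P.real {ω | t < ‖S ω‖} ≤ P.real {ω | Real.exp (θ * t) ≤
      trace (exp (θ • S ω)) + trace (exp (-θ • S ω))} :=
    measureReal_mono fun ω hω => exp_lt_trace_exp_add_trace_exp_neg (hSs ω) hθ0 ht hω
  refine hsubset.trans ?_
  rw [Real.exp_add, neg_mul, Real.exp_neg, mul_comm (Real.exp _)⁻¹, ← mul_assoc,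
    ← div_eq_mul_inv, le_div_iff₀ (Real.exp_pos _), mul_comm]
  exact hmk.trans hsum

end MatrixBernstein

/-! ### Decomposition of symmetric arrays over unordered pairs. -/

section EdgeIndicator

variable {n : ℕ}

/-- The indicator that the unordered pair `q` joins `i` and `k`. -/
def pairIndicator (q : {q : Fin n × Fin n // q.1 ≤ q.2}) (i k : Fin n) : ℝ :=
  if (q.1.1 = i ∧ q.1.2 = k) ∨ (q.1.1 = k ∧ q.1.2 = i) then 1 else 0

theorem pairIndicator_comm (q : {q : Fin n × Fin n // q.1 ≤ q.2}) (i k : Fin n) :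
    pairIndicator q i k = pairIndicator q k i := by
  unfold pairIndicator
  congr 1
  exact propext or_comm

theorem pairIndicator_sq (q : {q : Fin n × Fin n // q.1 ≤ q.2}) (i k : Fin n) :
    pairIndicator q i k * pairIndicator q i k = pairIndicator q i k := by
  unfold pairIndicator
  split_ifs <;> simp

/-- A walk of two steps along the same edge, or loop, returns to its start; hence squares of
one-edge matrices are diagonal. -/
theorem pairIndicator_mul_of_ne (q : {q : Fin n × Fin n // q.1 ≤ q.2}) {i j : Fin n} (h : i ≠ j)
    (k : Fin n) : pairIndicator q i k * pairIndicator q k j = 0 := by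
  unfold pairIndicator
  split_ifs <;> grind

theorem sum_mul_pairIndicator {f : Fin n → Fin n → ℝ} (hf : ∀ i j, f i j = f j i) (i k : Fin n) :
    ∑ q : {q : Fin n × Fin n // q.1 ≤ q.2}, f q.1.1 q.1.2 * pairIndicator q i k = f i k := by
  wlog h : i ≤ k generalizing i k
  · simp_rw [pairIndicator_comm _ i k, hf i k]
    exact this k i (le_of_not_ge h)
  rw [Finset.sum_eq_single ⟨(i, k), h⟩]
  · simp [pairIndicator]
  · rintro ⟨⟨a, b⟩, hab⟩ - hne
    have : ¬((a = i ∧ b = k) ∨ (a = k ∧ b = i)) := by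
      rintro (⟨rfl, rfl⟩ | ⟨rfl, rfl⟩)
      · exact hne rfl
      · exact hne (by simp [le_antisymm h hab])
    simp [pairIndicator, this]
  · simp

/-- Row `i` of a one-edge matrix is zero or has a single entry, at the other endpoint `j`. The
endpoint serves all `f` simultaneously, which lets sums with different summands be compared. -/
theorem sum_mul_pairIndicator_eq (q : {q : Fin n × Fin n // q.1 ≤ q.2}) (i : Fin n) :
    (∀ f : Fin n → ℝ, ∑ k, f k * pairIndicator q i k = 0) ∨
      ∃ j, ∀ f : Fin n → ℝ, ∑ k, f k * pairIndicator q i k = f j := by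
  by_cases h1 : q.1.1 = i
  · refine Or.inr ⟨q.1.2, fun f => ?_⟩
    rw [Finset.sum_eq_single q.1.2]
    · simp [pairIndicator, h1]
    · intro k _ hk
      have : ¬((q.1.1 = i ∧ q.1.2 = k) ∨ (q.1.1 = k ∧ q.1.2 = i)) := by grind
      simp [pairIndicator, this]
    · simp
  by_cases h2 : q.1.2 = i
  · refine Or.inr ⟨q.1.1, fun f => ?_⟩
    rw [Finset.sum_eq_single q.1.1]
    · simp [pairIndicator, h2]
    · intro k _ hk
      have : ¬((q.1.1 = i ∧ q.1.2 = k) ∨ (q.1.1 = k ∧ q.1.2 = i)) := by grind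
      simp [pairIndicator, this]
    · simp
  · exact Or.inl fun f => by simp [pairIndicator, h1, h2]

end EdgeIndicator

/-! ### Tail bounds for adjacency and degree deviations. -/

namespace EdgeIndicators

open Matrix

variable {n : ℕ} {p : EdgeProb n} {Ω : Type*} [MeasurableSpace Ω] {P : Measure Ω}

theorem integral_eq (X : EdgeIndicators p P) (i j : Fin n) :
    ∫ ω, X.I i j ω ∂P = p.p i j := by
  rw [← X.prob_one i j]
  have hm : MeasurableSet {ω | X.I i j ω = 1} := X.measurable i j (measurableSet_singleton 1)
  rw [← integral_indicator_one hm]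
  congr 1
  ext ω
  rcases X.zero_or_one i j ω with h | h <;> simp [h]

theorem adjMatrix_graph (X : EdgeIndicators p P) (ω : Ω) (i j : Fin n) :
    (X.graph ω).adjMatrix i j = X.I i j ω := by
  rcases X.zero_or_one i j ω with h | h <;> simp [LoopGraph.adjMatrix, graph, h]

/-- Taking `r = 1` gives the adjacency bound; taking the typical degrees to the power `-1/2` gives
the Laplacian one. -/
theorem measureReal_lt_norm_conj_adjMatrix_sub_le [IsProbabilityMeasure P]
    (X : EdgeIndicators p P) (r : Fin n → ℝ) {R σ θ t : ℝ} (hr : ∀ i k, |r i * r k| ≤ R)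
    (hR : 0 ≤ R) (hθ0 : 0 ≤ θ) (hθ : θ * R ≤ 1) (ht : 0 ≤ t)
    (hσ : ∀ i, ∑ k, p.p i k * (r i * r k) ^ 2 ≤ σ) :
    P.real {ω | t < ‖diagonal r * ((X.graph ω).adjMatrix - p.typ.adjMatrix) * diagonal r‖} ≤
      2 * n * Real.exp (-θ * t + θ ^ 2 * σ) := by
  set M : {q : Fin n × Fin n // q.1 ≤ q.2} → Matrix (Fin n) (Fin n) ℝ := fun q =>
    of fun i k => (r i * r k) * pairIndicator q i k with hMdef
  have hM : ∀ q, (M q).IsSymm := fun q => by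
    ext i k
    simp [M, pairIndicator_comm q i k, mul_comm (r i)]
  have hsq : ∀ q, M q ^ 2 = diagonal fun i => ∑ k, (r i * r k) ^ 2 * pairIndicator q i k := by
    intro q
    ext i j
    rw [sq, mul_apply]
    by_cases hij : i = j
    · subst hij
      rw [diagonal_apply_eq]
      refine Finset.sum_congr rfl fun k _ => ?_
      simp only [M, of_apply]
      rw [pairIndicator_comm q k i, ← pairIndicator_sq q i k]
      ring_nf
      rw [show pairIndicator q i k ^ 4 = (pairIndicator q i k * pairIndicator q i k) *
        (pairIndicator q i k * pairIndicator q i k) by ring]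
      simp only [pairIndicator_sq, sq]
    · rw [diagonal_apply_ne _ hij]
      refine Finset.sum_eq_zero fun k _ => ?_
      simp only [M, of_apply]
      rw [mul_mul_mul_comm, pairIndicator_mul_of_ne q hij, mul_zero]
  have hnorm : ∀ q, ‖M q‖ ≤ R := by
    intro q
    -- By the C*-identity the norm can be read off the diagonal square.
    have h1 : ‖M q‖ * ‖M q‖ = ‖M q ^ 2‖ := by
      rw [← l2_opNorm_conjTranspose_mul_self, conjTranspose_eq_transpose_of_trivial, (hM q).eq, sq]
    have h2 : ‖M q ^ 2‖ ≤ R * R := by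
      rw [hsq, l2_opNorm_diagonal, pi_norm_le_iff_of_nonneg (by positivity)]
      intro i
      rcases sum_mul_pairIndicator_eq q i with h | ⟨j, h⟩
      · rw [h]; simpa using mul_nonneg hR hR
      · rw [h, Real.norm_eq_abs, abs_pow, sq]
        exact mul_le_mul (hr i j) (hr i j) (abs_nonneg _) hR
    exact abs_le_of_sq_le_sq' (by rw [sq, sq, h1]; exact h2) hR |>.2
  have key := measureReal_lt_norm_sum_bernoulli_le (P := P)
    (J := fun q : {q : Fin n × Fin n // q.1 ≤ q.2} => X.I q.1.1 q.1.2)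
    (fun q => X.measurable _ _) (fun q => X.zero_or_one _ _) X.indep hM (σ := σ)
    (v := fun i => ∑ k, p.p i k * (r i * r k) ^ 2) (θ := θ) (t := t) ?_ hσ hθ0
    (fun q => (mul_le_mul_of_nonneg_left (hnorm q) hθ0).trans hθ) ht
  · rw [Fintype.card_fin] at key
    convert key using 6 with ω
    ext i k
    rw [mul_diagonal, diagonal_mul, Matrix.sum_apply]
    simp only [Matrix.smul_apply, M, of_apply, smul_eq_mul, X.integral_eq, Matrix.sub_apply, adjMatrix_graph]
    have h := sum_mul_pairIndicator (f := fun i k => (X.I i k ω - p.p i k))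
      (fun i j => by rw [X.symm i j, p.symm i j]) i k
    calc _ = (r i * r k) * (X.I i k ω - p.p i k) := by
          simp only [WeightedGraph.adjMatrix, EdgeProb.typ, of_apply]; ring
      _ = _ := by
          rw [← h, Finset.mul_sum]
          exact Finset.sum_congr rfl fun q _ => by ring
  · simp only [X.integral_eq, hsq, ← diagonal_smul]
    ext i j
    rw [Matrix.sum_apply]
    by_cases hij : i = j
    · subst hij
      simp only [diagonal_apply_eq, Pi.smul_apply, smul_eq_mul, Finset.mul_sum]
      rw [Finset.sum_comm]
      refine Finset.sum_congr rfl fun k _ => ?_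
      rw [← sum_mul_pairIndicator p.symm i k, Finset.sum_mul]
      exact Finset.sum_congr rfl fun q _ => by ring
    · simp [diagonal_apply_ne _ hij]

/-- Placed on a diagonal, the scaled degree errors become a matrix sum whose operator norm is their
maximum, so the same Bernstein inequality covers all vertices at once. -/
theorem measureReal_lt_norm_degree_sub_le [IsProbabilityMeasure P]
    (X : EdgeIndicators p P) (s : Fin n → ℝ) {R σ θ t : ℝ} (hs : ∀ i, |s i| ≤ R)
    (hR : 0 ≤ R) (hθ0 : 0 ≤ θ) (hθ : θ * R ≤ 1) (ht : 0 ≤ t)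
    (hσ : ∀ i, ∑ k, p.p i k * s i ^ 2 ≤ σ) :
    P.real {ω | t < ‖fun i => s i * ∑ k, (X.I i k ω - p.p i k)‖} ≤
      2 * n * Real.exp (-θ * t + θ ^ 2 * σ) := by
  set M : {q : Fin n × Fin n // q.1 ≤ q.2} → Matrix (Fin n) (Fin n) ℝ := fun q =>
    diagonal fun i => ∑ k, s i * pairIndicator q i k with hMdef
  have hM : ∀ q, (M q).IsSymm := fun q => isSymm_diagonal _
  have hsq : ∀ q, M q ^ 2 = diagonal fun i => ∑ k, s i ^ 2 * pairIndicator q i k := by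
    intro q
    rw [sq, hMdef, diagonal_mul_diagonal]
    congr 1
    ext i
    rcases sum_mul_pairIndicator_eq q i with h | ⟨j, h⟩
    · rw [h, h, zero_mul]
    · rw [h, h, sq]
  have hnorm : ∀ q, ‖M q‖ ≤ R := by
    intro q
    rw [hMdef, l2_opNorm_diagonal, pi_norm_le_iff_of_nonneg hR]
    intro i
    rcases sum_mul_pairIndicator_eq q i with h | ⟨j, h⟩
    · rw [h]; simpa using hR
    · rw [h]; exact hs i
  have key := measureReal_lt_norm_sum_bernoulli_le (P := P)
    (J := fun q : {q : Fin n × Fin n // q.1 ≤ q.2} => X.I q.1.1 q.1.2)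
    (fun q => X.measurable _ _) (fun q => X.zero_or_one _ _) X.indep hM (σ := σ)
    (v := fun i => ∑ k, p.p i k * s i ^ 2) (θ := θ) (t := t) ?_ hσ hθ0
    (fun q => (mul_le_mul_of_nonneg_left (hnorm q) hθ0).trans hθ) ht
  · rw [Fintype.card_fin] at key
    convert key using 5 with ω
    simp only [M, ← diagonal_smul, X.integral_eq]
    rw [show ∑ q : {q : Fin n × Fin n // q.1 ≤ q.2},
      diagonal ((X.I q.1.1 q.1.2 ω - p.p q.1.1 q.1.2) • fun i => ∑ k, s i * pairIndicator q i k) =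
        diagonal fun i => s i * ∑ k, (X.I i k ω - p.p i k) from ?_, l2_opNorm_diagonal]
    ext i j
    rw [Matrix.sum_apply]
    by_cases hij : i = j
    · subst hij
      simp only [diagonal_apply_eq, Pi.smul_apply, smul_eq_mul, Finset.mul_sum]
      rw [Finset.sum_comm]
      refine Finset.sum_congr rfl fun k _ => ?_
      rw [← sum_mul_pairIndicator (f := fun i k => (X.I i k ω - p.p i k))
        (fun i j => by rw [X.symm i j, p.symm i j]) i k, Finset.mul_sum]
      exact Finset.sum_congr rfl fun q _ => by ring
    · simp [diagonal_apply_ne _ hij]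
  · simp only [X.integral_eq, hsq, ← diagonal_smul]
    ext i j
    rw [Matrix.sum_apply]
    by_cases hij : i = j
    · subst hij
      simp only [diagonal_apply_eq, Pi.smul_apply, smul_eq_mul, Finset.mul_sum]
      rw [Finset.sum_comm]
      refine Finset.sum_congr rfl fun k _ => ?_
      rw [← sum_mul_pairIndicator p.symm i k, Finset.sum_mul]
      exact Finset.sum_congr rfl fun q _ => by ring
    · simp [diagonal_apply_ne _ hij]

end EdgeIndicators

theorem LoopGraph.cast_degree {V : Type*} [Fintype V] (G : LoopGraph V) (i : V) :
    (G.degree i : ℝ) = ∑ j, G.adjMatrix i j := by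
  classical
  simp only [LoopGraph.adjMatrix, Matrix.of_apply, LoopGraph.degree]
  rw [Set.ncard_eq_toFinset_card', Finset.sum_boole]
  congr 2
  ext
  simp

/-! ### Perturbation of normalized matrices and numerical estimates. -/

namespace Matrix

variable {V : Type*} [Fintype V] [DecidableEq V]

/-- A symmetrically normalized non-negative symmetric matrix is a contraction. -/
theorem norm_diagonal_mul_mul_diagonal_le_one {A : Matrix V V ℝ} (hA : A.IsSymm)
    (h0 : ∀ i j, 0 ≤ A i j) {T : V → ℝ} (hT : ∀ i, T i ^ 2 * ∑ j, A i j = 1) :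
    ‖diagonal T * A * diagonal T‖ ≤ 1 := by
  rw [cstar_norm_def]
  refine ContinuousLinearMap.opNorm_le_bound _ zero_le_one fun x => ?_
  rw [one_mul, ← abs_of_nonneg (norm_nonneg (toEuclideanCLM (n := V) (𝕜 := ℝ) _ x)),
    ← abs_of_nonneg (norm_nonneg x)]
  refine sq_le_sq.1 ?_
  rw [EuclideanSpace.real_norm_sq_eq, EuclideanSpace.real_norm_sq_eq]
  have hx : ∀ i, toEuclideanCLM (n := V) (𝕜 := ℝ) (diagonal T * A * diagonal T) x i =
      ∑ j, T i * A i j * T j * x j := by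
    intro i
    rw [ofLp_toEuclideanCLM]
    simp [mulVec, dotProduct, mul_diagonal, diagonal_mul]
  -- Weighted Cauchy–Schwarz: the factor `∑ T i ^ 2 * A i j` is `1`, and summing over `i` uses the
  -- same identity for columns.
  have hrow : ∀ i, (∑ j, T i * A i j * T j * x j) ^ 2 ≤ ∑ j, A i j * (T j ^ 2 * x j ^ 2) := by
    intro i
    have h1 := Finset.sum_sq_le_sum_mul_sum_of_sq_le_mul Finset.univ
      (r := fun j => T i * A i j * T j * x j) (f := fun j => T i ^ 2 * A i j)
      (g := fun j => A i j * (T j ^ 2 * x j ^ 2))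
      (fun j _ => mul_nonneg (sq_nonneg _) (h0 i j))
      (fun j _ => mul_nonneg (h0 i j) (by positivity)) (fun j _ => le_of_eq (by ring))
    rwa [← Finset.mul_sum, hT, one_mul] at h1
  calc _ ≤ ∑ i, ∑ j, A i j * (T j ^ 2 * x j ^ 2) :=
        Finset.sum_le_sum fun i _ => by rw [hx]; exact hrow i
    _ = ∑ j, x j ^ 2 := by
        rw [Finset.sum_comm]
        refine Finset.sum_congr rfl fun j _ => ?_
        rw [← Finset.sum_mul, ← mul_assoc, mul_comm (∑ i, A i j)]
        have : ∑ i, A i j = ∑ i, A j i := Finset.sum_congr rfl fun i _ => (hA.apply _ _)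
        rw [this, hT, one_mul]

theorem norm_diagonal_mul_mul_diagonal_sub_le {N : Matrix V V ℝ} (hN : ‖N‖ ≤ 1) {g : V → ℝ} {t : ℝ}
    (ht : 0 ≤ t) (hg : ∀ i, |g i - 1| ≤ t) :
    ‖diagonal g * N * diagonal g - N‖ ≤ t * (2 + t) := by
  have h1 : ‖diagonal g - 1‖ ≤ t := by
    rw [← diagonal_one, diagonal_sub, l2_opNorm_diagonal, pi_norm_le_iff_of_nonneg ht]
    exact hg
  have h2 : ‖diagonal g‖ ≤ 1 + t := by
    rw [l2_opNorm_diagonal, pi_norm_le_iff_of_nonneg (by linarith)]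
    intro i
    have := abs_le.1 (hg i)
    exact abs_le.2 ⟨by linarith, by linarith⟩
  have h3 : diagonal g * N * diagonal g - N =
      (diagonal g - 1) * N * diagonal g + N * (diagonal g - 1) := by noncomm_ring
  calc ‖diagonal g * N * diagonal g - N‖
      ≤ ‖diagonal g - 1‖ * ‖N‖ * ‖diagonal g‖ + ‖N‖ * ‖diagonal g - 1‖ := by
        rw [h3]
        refine (norm_add_le _ _).trans (add_le_add ((norm_mul_le _ _).trans ?_) (norm_mul_le _ _))
        gcongr
        exact norm_mul_le _ _
    _ ≤ t * 1 * (1 + t) + 1 * t := by gcongr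
    _ = t * (2 + t) := by ring

end Matrix

theorem one_sub_le_measureReal_of_compl_subset {Ω : Type*} [MeasurableSpace Ω] {P : Measure Ω}
    [IsProbabilityMeasure P] {s t : Set Ω} {δ : ℝ} (h : sᶜ ⊆ t) (ht : P.real t ≤ δ) :
    1 - δ ≤ P.real s := by
  have h1 : P.real (s ∪ t) = 1 := by
    rw [show s ∪ t = Set.univ from Set.eq_univ_of_forall fun ω => by
      by_cases hω : ω ∈ s
      · exact Or.inl hω
      · exact Or.inr (h hω)]
    simp
  have h2 := measureReal_union_le (μ := P) s t
  linarith

/-- The bound is `δ / 2` rather than `δ` because the Laplacian estimate takes a union of two bad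
events. -/
theorem two_mul_exp_neg_four_mul_log_le {n x δ : ℝ} (hn : 2 ≤ n) (hx : n ≤ x) (hδ0 : 0 < δ)
    (hδ : δ ≤ 1 / 2) : 2 * n * Real.exp (-4 * Real.log (x / δ)) ≤ δ / 2 := by
  have hx0 : 0 < x := by linarith
  have h1 : Real.exp (-4 * Real.log (x / δ)) = (δ / x) ^ 4 := by
    rw [show -4 * Real.log (x / δ) = (4 : ℕ) * Real.log (δ / x) by
      rw [← inv_div δ x, Real.log_inv]; push_cast; ring, Real.exp_nat_mul,
      Real.exp_log (by positivity)]
  have h2 : δ / x ≤ 1 / 4 := by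
    rw [div_le_iff₀ hx0]; linarith
  have h3 : n * (δ / x) ≤ δ := by
    rw [← mul_div_assoc, div_le_iff₀ hx0]; nlinarith
  have h4 : 0 ≤ δ / x := by positivity
  rw [h1]
  have h5 : (δ / x) ^ 3 ≤ (1 / 4) ^ 3 := by gcongr
  have h6 : 0 ≤ (δ / x) ^ 3 := by positivity
  calc 2 * n * (δ / x) ^ 4 = 2 * (n * (δ / x)) * (δ / x) ^ 3 := by ring
    _ ≤ 2 * δ * (1 / 4) ^ 3 := by gcongr
    _ ≤ δ / 2 := by nlinarith

theorem log_div_le_mul_log {n x δ a c : ℝ} (hn : 1 ≤ n) (hx0 : 0 < x) (hx : x ≤ n ^ a)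
    (hδ : n ^ (-c) ≤ δ) : Real.log (x / δ) ≤ (a + c) * Real.log n := by
  have hn0 : 0 < n := by linarith
  have hδ0 : 0 < δ := (Real.rpow_pos_of_pos hn0 _).trans_le hδ
  have h1 := Real.log_le_log hx0 hx
  have h2 := Real.log_le_log (Real.rpow_pos_of_pos hn0 _) hδ
  rw [Real.log_rpow hn0] at h1 h2
  rw [Real.log_div hx0.ne' hδ0.ne']
  linarith

theorem abs_sqrt_sub_one_le {x : ℝ} (hx : 0 ≤ x) : |√x - 1| ≤ |x - 1| := by
  have h : x - 1 = (√x - 1) * (√x + 1) := by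
    nlinarith [Real.mul_self_sqrt hx]
  rw [h, abs_mul]
  have h2 : 1 ≤ |√x + 1| := by
    rw [abs_of_nonneg (by positivity)]
    linarith [Real.sqrt_nonneg x]
  exact le_mul_of_one_le_right (abs_nonneg _) h2

namespace WeightedGraph

variable {V : Type*} [Fintype V] (H : WeightedGraph V)

theorem degree_le_maxDegree (i : V) : H.degree i ≤ H.maxDegree :=
  le_ciSup (Set.finite_range H.degree).bddAbove i

theorem minDegree_le_degree (i : V) : H.minDegree ≤ H.degree i :=
  ciInf_le (Set.finite_range H.degree).bddBelow i

end WeightedGraph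

/-! ### The two concentration bounds. -/

namespace EdgeIndicators

open Matrix

variable {n : ℕ} {p : EdgeProb n} {Ω : Type*} [MeasurableSpace Ω] {P : Measure Ω}

/-- The normalized Laplacians are close as soon as the conjugated adjacency matrices and the
degrees are. -/
theorem norm_laplacian_sub_le (X : EdgeIndicators p P) (ω : Ω) {t : ℝ}
    (hpos : ∀ i, 0 < p.typ.degree i) (ht0 : 0 ≤ t) (ht : t ≤ 1 / 2)
    (hA : ‖diagonal (fun i => p.typ.degree i ^ (-(1 / 2) : ℝ)) *
      ((X.graph ω).adjMatrix - p.typ.adjMatrix) *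
        diagonal (fun i => p.typ.degree i ^ (-(1 / 2) : ℝ))‖ ≤ t)
    (hd : ‖fun i => (p.typ.degree i)⁻¹ * ∑ k, (X.I i k ω - p.p i k)‖ ≤ t) :
    ‖(X.graph ω).laplacian - p.typ.laplacian‖ ≤ 7 / 2 * t := by
  set A := (X.graph ω).adjMatrix with hAdef
  set B := p.typ.adjMatrix with hBdef
  set r : Fin n → ℝ := fun i => p.typ.degree i ^ (-(1 / 2) : ℝ) with hr
  set dω : Fin n → ℝ := fun i => ((X.graph ω).degree i : ℝ) with hdω
  have hdeg : ∀ i, dω i = ∑ k, X.I i k ω := fun i => by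
    simp only [hdω, LoopGraph.cast_degree, adjMatrix_graph]
  have hratio : ∀ i, |dω i / p.typ.degree i - 1| ≤ t := by
    intro i
    have h := (norm_le_pi_norm _ i).trans hd
    rw [Finset.sum_sub_distrib, ← hdeg, Real.norm_eq_abs] at h
    have hsub : dω i / p.typ.degree i - 1 =
        (p.typ.degree i)⁻¹ * (dω i - ∑ k, p.p i k) := by
      rw [show ∑ k, p.p i k = p.typ.degree i from rfl, mul_sub, inv_mul_cancel₀ (hpos i).ne',
        div_eq_inv_mul]
    rwa [hsub]
  -- A relative error of at most `1/2` excludes isolated vertices, so the zero branch in the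
  -- Laplacian never occurs.
  have hωpos : ∀ i, 0 < dω i := by
    intro i
    have h := (abs_le.1 (hratio i)).1
    have h2 : 0 < dω i / p.typ.degree i := by linarith
    exact (div_pos_iff_of_pos_right (hpos i)).1 h2
  set T : Fin n → ℝ := fun i => dω i ^ (-(1 / 2) : ℝ) with hT
  set g : Fin n → ℝ := fun i => √(dω i / p.typ.degree i) with hg
  have hsqrt : ∀ x : ℝ, 0 < x → x ^ (-(1 / 2) : ℝ) = (√x)⁻¹ := fun x hx => by
    rw [Real.rpow_neg hx.le, Real.sqrt_eq_rpow]
  have hgT : r = fun i => g i * T i := by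
    ext i
    have h1 := Real.sqrt_pos.2 (hpos i)
    have h2 := Real.sqrt_pos.2 (hωpos i)
    simp only [hr, hg, hT]
    rw [hsqrt _ (hpos i), hsqrt _ (hωpos i), Real.sqrt_div (hωpos i).le]
    field_simp
  have hL : (X.graph ω).laplacian = 1 - diagonal T * A * diagonal T := by
    have h : (fun i => if dω i = 0 then 0 else dω i ^ (-(1 / 2) : ℝ)) = T := by
      ext i
      simp only [(hωpos i).ne', if_false, hT]
    rw [LoopGraph.laplacian, laplacianOf, ← h]
  have hLt : p.typ.laplacian = 1 - diagonal r * B * diagonal r := by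
    have h : (fun i => if p.typ.degree i = 0 then 0 else p.typ.degree i ^ (-(1 / 2) : ℝ)) = r := by
      ext i
      simp only [(hpos i).ne', if_false, hr]
    rw [WeightedGraph.laplacian, laplacianOf, ← h]
  have hN : ‖diagonal T * A * diagonal T‖ ≤ 1 := by
    refine norm_diagonal_mul_mul_diagonal_le_one ?_ ?_ ?_
    · ext i j
      simp only [transpose_apply, hAdef, adjMatrix_graph]
      rw [X.symm]
    · intro i j
      rw [hAdef, adjMatrix_graph]
      rcases X.zero_or_one i j ω with h | h <;> simp [h]
    · intro i
      rw [hAdef, ← LoopGraph.cast_degree]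
      change T i ^ 2 * dω i = 1
      simp only [hT]
      rw [hsqrt _ (hωpos i), inv_pow, Real.sq_sqrt (hωpos i).le, inv_mul_cancel₀ (hωpos i).ne']
  have hrA : diagonal r * A * diagonal r =
      diagonal g * (diagonal T * A * diagonal T) * diagonal g := by
    have h1 : diagonal r = diagonal g * diagonal T := by rw [diagonal_mul_diagonal, hgT]
    have h2 : diagonal r = diagonal T * diagonal g := by
      rw [diagonal_mul_diagonal, hgT]
      simp only [mul_comm]
    nth_rewrite 1 [h1]
    rw [h2]
    simp only [mul_assoc]
  -- The intermediate matrix is the random adjacency matrix normalized by the typical degrees.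
  have hsplit : (X.graph ω).laplacian - p.typ.laplacian =
      (diagonal g * (diagonal T * A * diagonal T) * diagonal g - diagonal T * A * diagonal T) -
        diagonal r * (A - B) * diagonal r := by
    rw [hL, hLt, ← hrA]
    noncomm_ring
  have hdev := norm_diagonal_mul_mul_diagonal_sub_le hN ht0 (g := g) fun i =>
    (abs_sqrt_sub_one_le (div_pos (hωpos i) (hpos i)).le).trans (hratio i)
  rw [hsplit]
  calc _ ≤ t * (2 + t) + t := (norm_sub_le _ _).trans (add_le_add hdev hA)
    _ ≤ 7 / 2 * t := by nlinarith

theorem adjMatrix_concentration [IsProbabilityMeasure P] (X : EdgeIndicators p P) {δ : ℝ}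
    (hn : 2 ≤ n) (hδ0 : 0 < δ) (hδ : δ ≤ 1 / 2)
    (hΔ : 4 * Real.log (n / δ) ≤ p.typ.maxDegree) :
    1 - δ ≤ P.real {ω | opNormL2 ((X.graph ω).adjMatrix - p.typ.adjMatrix)
      ≤ 4 * √(p.typ.maxDegree * Real.log (n / δ))} := by
  set L := Real.log (n / δ) with hL
  set Δ := p.typ.maxDegree with hΔdef
  have hn' : (2 : ℝ) ≤ n := by exact_mod_cast hn
  have hL0 : 0 < L := Real.log_pos (by rw [lt_div_iff₀ hδ0]; linarith)
  have hΔ0 : 0 < Δ := by linarith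
  -- `θ = t / (2σ)` minimizes `-θt + θ²σ`, giving the exponent `-4L`. The hypothesis `4 L ≤ Δ`
  -- ensures `θ ≤ 1`.
  have key := X.measureReal_lt_norm_conj_adjMatrix_sub_le (fun _ => 1) (R := 1) (σ := Δ)
    (θ := 2 * √(L / Δ)) (t := 4 * √(Δ * L)) (by simp) zero_le_one (by positivity) ?_
    (by positivity) ?_
  · have hexp : -(2 * √(L / Δ)) * (4 * √(Δ * L)) + (2 * √(L / Δ)) ^ 2 * Δ = -4 * L := by
      have h1 : √(L / Δ) * √(Δ * L) = L := by
        rw [← Real.sqrt_mul (by positivity), show L / Δ * (Δ * L) = L ^ 2 by field_simp,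
          Real.sqrt_sq hL0.le]
      have h2 : √(L / Δ) ^ 2 * Δ = L := by
        rw [Real.sq_sqrt (by positivity)]; field_simp
      linear_combination -8 * h1 + 4 * h2
    rw [hexp] at key
    refine one_sub_le_measureReal_of_compl_subset (fun ω hω => ?_)
      (key.trans ((two_mul_exp_neg_four_mul_log_le hn' le_rfl hδ0 hδ).trans (by linarith)))
    simpa [opNormL2, cstar_norm_def] using hω
  · have : √(L / Δ) ≤ 1 / 2 := by
      rw [Real.sqrt_le_left (by norm_num), div_le_iff₀ hΔ0]; linarith
    linarith
  · intro i
    simp only [mul_one, one_pow]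
    exact p.typ.degree_le_maxDegree i

theorem laplacian_concentration [IsProbabilityMeasure P] (X : EdgeIndicators p P) {δ : ℝ}
    (hn : 2 ≤ n) (hδ0 : 0 < δ) (hδ : δ ≤ 1 / 2)
    (hd : 64 * Real.log (4 * n / δ) ≤ p.typ.minDegree) :
    1 - δ ≤ P.real {ω | opNormL2 ((X.graph ω).laplacian - p.typ.laplacian)
      ≤ 14 * √(Real.log (4 * n / δ) / p.typ.minDegree)} := by
  set L := Real.log (4 * n / δ) with hL
  set d := p.typ.minDegree with hddef
  have hn' : (2 : ℝ) ≤ n := by exact_mod_cast hn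
  have hL0 : 0 < L := Real.log_pos (by rw [lt_div_iff₀ hδ0]; linarith)
  have hd0 : 0 < d := by linarith
  have hdi : ∀ i, d ≤ p.typ.degree i := p.typ.minDegree_le_degree
  have hpos : ∀ i, 0 < p.typ.degree i := fun i => hd0.trans_le (hdi i)
  have hinv : ∀ i, (p.typ.degree i)⁻¹ ≤ d⁻¹ := fun i => inv_anti₀ hd0 (hdi i)
  set u := √(L / d) with hu
  -- The factor `64` makes the deviation `4 * u` at most `1/2`, as `norm_laplacian_sub_le` requires;
  -- its factor `7/2` then yields `14 * u`.
  have hu8 : u ≤ 1 / 8 := by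
    rw [hu, Real.sqrt_le_left (by norm_num), div_le_iff₀ hd0]; linarith
  have hu2 : u ^ 2 * d = L := by
    rw [hu, Real.sq_sqrt (by positivity)]; field_simp
  have hu0 : 0 ≤ u := Real.sqrt_nonneg _
  have hexp : -(2 * u * d) * (4 * u) + (2 * u * d) ^ 2 * d⁻¹ = -4 * L := by
    rw [← hu2]; field_simp; ring
  have hθR : 2 * u * d * d⁻¹ ≤ 1 := by
    rw [mul_assoc, mul_inv_cancel₀ hd0.ne']; linarith
  have hdegsum : ∀ i, ∑ k, p.p i k * (p.typ.degree i)⁻¹ = 1 := fun i => by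
    rw [← Finset.sum_mul]; exact mul_inv_cancel₀ (hpos i).ne'
  have hr2 : ∀ i, (p.typ.degree i ^ (-(1 / 2) : ℝ)) ^ 2 = (p.typ.degree i)⁻¹ := fun i => by
    rw [← Real.rpow_natCast, ← Real.rpow_mul (hpos i).le, ← Real.rpow_neg_one]
    norm_num
  have hA := X.measureReal_lt_norm_conj_adjMatrix_sub_le
    (fun i => p.typ.degree i ^ (-(1 / 2) : ℝ)) (R := d⁻¹) (σ := d⁻¹) (θ := 2 * u * d)
    (t := 4 * u) (fun i k => ?_) (by positivity) (by positivity) hθR (by positivity) ?_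
  · have hD := X.measureReal_lt_norm_degree_sub_le (fun i => (p.typ.degree i)⁻¹) (R := d⁻¹)
      (σ := d⁻¹) (θ := 2 * u * d) (t := 4 * u)
      (fun i => by rw [abs_of_pos (inv_pos.2 (hpos i))]; exact hinv i)
      (by positivity) (by positivity) hθR (by positivity) ?_
    · rw [hexp] at hA hD
      have hb := two_mul_exp_neg_four_mul_log_le hn' (x := 4 * n) (by linarith) hδ0 hδ
      refine one_sub_le_measureReal_of_compl_subset (fun ω hω => ?_)
        ((measureReal_union_le _ _).trans
          ((add_le_add (hA.trans hb) (hD.trans hb)).trans_eq (add_halves δ)))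
      by_contra hcon
      simp only [Set.mem_union, Set.mem_ofPred_eq, not_or, not_lt] at hcon
      refine hω ((X.norm_laplacian_sub_le ω hpos (by positivity) (by linarith)
        hcon.1 hcon.2).trans_eq ?_)
      ring
    · intro i
      calc ∑ k, p.p i k * (p.typ.degree i)⁻¹ ^ 2
          = (∑ k, p.p i k * (p.typ.degree i)⁻¹) * (p.typ.degree i)⁻¹ := by
            rw [Finset.sum_mul]; exact Finset.sum_congr rfl fun k _ => by ring
        _ ≤ d⁻¹ := by rw [hdegsum, one_mul]; exact hinv i
  · refine abs_le_of_sq_le_sq ?_ (by positivity)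
    rw [mul_pow, hr2, hr2, sq]
    exact mul_le_mul (hinv i) (hinv k) (inv_pos.2 (hpos k)).le (by positivity)
  · intro i
    calc ∑ k, p.p i k * (p.typ.degree i ^ (-(1 / 2) : ℝ) * p.typ.degree k ^ (-(1 / 2) : ℝ)) ^ 2
        ≤ ∑ k, p.p i k * (p.typ.degree i)⁻¹ * d⁻¹ := by
          refine Finset.sum_le_sum fun k _ => ?_
          rw [mul_pow, hr2, hr2, ← mul_assoc]
          exact mul_le_mul_of_nonneg_left (hinv k)
            (mul_nonneg (p.nonneg i k) (inv_pos.2 (hpos i)).le)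
      _ = d⁻¹ := by rw [← Finset.sum_mul, hdegsum, one_mul]

end EdgeIndicators

theorem theorem4 (c : ℝ) (hc : 0 < c) :
    ∃ C : ℝ, 0 < C ∧
      ∀ (n : ℕ), 2 ≤ n → ∀ (p : EdgeProb n)
        (Ω : Type*) [MeasurableSpace Ω] (P : Measure Ω) [IsProbabilityMeasure P]
        (X : EdgeIndicators p P),
        (C * Real.log n < p.typ.maxDegree →
          ∀ δ : ℝ, (n : ℝ) ^ (-c) ≤ δ → δ ≤ 1 / 2 →
            1 - δ ≤ P.real {ω | opNormL2 ((X.graph ω).adjMatrix - p.typ.adjMatrix)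
              ≤ 4 * √(p.typ.maxDegree * Real.log (n / δ))}) ∧
        (C * Real.log n ≤ p.typ.minDegree →
          ∀ δ : ℝ, (n : ℝ) ^ (-c) ≤ δ → δ ≤ 1 / 2 →
            1 - δ ≤ P.real {ω | opNormL2 ((X.graph ω).laplacian - p.typ.laplacian)
              ≤ 14 * √(Real.log (4 * n / δ) / p.typ.minDegree)}) := by
  -- Since `4n ≤ n³` for `n ≥ 2`, `log (4n/δ) ≤ (3 + c) log n`; the factor `64` comes from
  -- `laplacian_concentration`. The adjacency bound needs less.
  refine ⟨64 * (3 + c), by positivity, fun n hn p Ω _ P _ X => ?_⟩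
  have hn' : (2 : ℝ) ≤ n := by exact_mod_cast hn
  have hlog : 0 < Real.log n := Real.log_pos (by linarith)
  have hδ0 : ∀ δ : ℝ, (n : ℝ) ^ (-c) ≤ δ → 0 < δ := fun δ h =>
    (Real.rpow_pos_of_pos (by linarith) _).trans_le h
  refine ⟨fun hΔ δ h1 h2 => X.adjMatrix_concentration hn (hδ0 δ h1) h2 ?_,
    fun hd δ h1 h2 => X.laplacian_concentration hn (hδ0 δ h1) h2 ?_⟩
  · have h := log_div_le_mul_log (x := n) (a := 1) (by linarith) (by linarith) (by simp) h1
    nlinarith [mul_pos hc hlog]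
  · have h := log_div_le_mul_log (x := 4 * n) (a := 3) (by linarith) (by linarith) (by
      rw [show (3 : ℝ) = (3 : ℕ) by norm_num, Real.rpow_natCast]
      nlinarith [mul_nonneg (sub_nonneg.2 hn') (sq_nonneg (n : ℝ))]) h1
    nlinarith
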